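/- Let $p$ be a prime and let $\mathrm{PG}(2,p)$ be the projective plane over the field $\mathbb{F}_p$. A set without tangents in $\mathrm{PG}(2,p)$ is a set $\mathcal{S}$ of points such that no line meets $\mathcal{S}$ in exactly one point. Let $\mathcal{S}$ be a non-empty set without tangents in $\mathrm{PG}(2,p)$ with $|\mathcal{S}|\leq 2p$. If there is a line containing exactly $x$ points of $\mathcal{S}$, where $x\geq \frac{|\mathcal{S}|}{2}-\frac{p-1}{4}$, then $\mathcal{S}$ is trivial, that is, there are two different lines $L_1$ and $L_2$ such that $\mathcal{S}=(L_1\cup L_2)\setminus(L_1\cap L_2)$ (all points on the two lines except their intersection point). -/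

import Mathlib

namespace PG2

/-- The points of the projective plane `PG(2, p)` over the prime field `ZMod p`: the
one-dimensional subspaces of `(ZMod p)³`. Mathlib's incidence structure on this type
(`Configuration.ofField`) also uses it for the lines: `⟨(a, b, c)⟩` stands for the line with
equation `a X + b Y + c Z = 0`. -/
abbrev Point (p : ℕ) [Fact p.Prime] : Type :=
  Projectivization (ZMod p) (Fin 3 → ZMod p)

/-- The lines of `PG(2, p)`, given by the coefficients of their equations up to scalars. -/
abbrev Line (p : ℕ) [Fact p.Prime] : Type :=
  Projectivization (ZMod p) (Fin 3 → ZMod p)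

/-- The set of points on a line, for Mathlib's incidence relation: the point `⟨v⟩` is on the line
`⟨w⟩` if and only if `v ⬝ᵥ w = 0`. -/
def Line.points {p : ℕ} [Fact p.Prime] (L : Line p) : Set (Point p) :=
  {P : Point p | P ∈ L}

theorem mk_mem_points {p : ℕ} [Fact p.Prime] (v w : Fin 3 → ZMod p) (hv : v ≠ 0) (hw : w ≠ 0) :
    Projectivization.mk (ZMod p) v hv ∈ Line.points (Projectivization.mk (ZMod p) w hw) ↔
      v ⬝ᵥ w = 0 :=
  Projectivization.orthogonal_mk hv hw

/-- A set without tangents: no line meets it in exactly one point. -/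
def WithoutTangents {p : ℕ} [Fact p.Prime] (S : Set (Point p)) : Prop :=
  ∀ L : Line p, (S ∩ Line.points L).ncard ≠ 1

/-- A trivial set without tangents: all the points on two different lines, except for the
intersection point of these lines. -/
def IsTrivial {p : ℕ} [Fact p.Prime] (S : Set (Point p)) : Prop :=
  ∃ L₁ L₂ : Line p, L₁ ≠ L₂ ∧
    S = (Line.points L₁ ∪ Line.points L₂) \ (Line.points L₁ ∩ Line.points L₂)

end PG2

/-! ### Lacunary polynomials that split over the prime field. -/

section Lacunary

open Polynomial

/-! Let `B` be the symmetric difference of `S` and `L`. It is a blocking set: a line other than `L`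
meets `L` either outside `S`, or in a point of `S`, and then has a second point of `S`, off `L`. The
bound on `x` says exactly that `|B| < 3(p+1)/2`, so by Blokhuis `B` contains a line `M`. Thus `S`
contains `M` minus the point `L ∩ M`; counting along pencils gives the same for `L`, and `|S| ≤ 2p`
leaves room for nothing else.

For Blokhuis's theorem, take a tangent at an essential point `P` as line at infinity. The other
points of `B` meet every affine line not through `P`, so their Rédei polynomial vanishes everywhere.
The Nullstellensatz makes its top-degree part lacunary, of the form `X ^ p * g + h` with `g`, `h` of
small degree. Such a split polynomial vanishes on the whole field or has a `p`-fold root. The former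
gives an affine blocking set, too small by Jamison's bound; the latter gives a line through `P`
inside `B`. -/

theorem splits_dvd_mul_wronskian {p : ℕ} [Fact p.Prime] {g h : (ZMod p)[X]}
    (h0 : X ^ p * g + h ≠ 0) (hs : (X ^ p * g + h).Splits)
    (hne : (X * g + h) * (derivative h * g - derivative g * h) ≠ 0) :
    X ^ p * g + h ∣ (X * g + h) * (derivative h * g - derivative g * h) := by
  classical
  refine hs.dvd_of_roots_le_roots h0 (Multiset.le_iff_count.2 fun c ↦ ?_)
  rw [count_roots, count_roots, le_rootMultiplicity_iff hne]
  rcases Nat.eq_zero_or_pos (rootMultiplicity c (X ^ p * g + h)) with hm | hm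
  · simp [hm]
  have hroot : (X ^ p * g + h).IsRoot c := (rootMultiplicity_pos h0).1 hm
  have hd : (X - C c) ^ rootMultiplicity c (X ^ p * g + h) ∣ X ^ p * g + h :=
    pow_rootMultiplicity_dvd _ _
  have hd' := pow_sub_one_dvd_derivative_of_pow_dvd hd
  -- On the prime field `c ^ p = c`.
  have h1 : X - C c ∣ X * g + h := by
    rw [dvd_iff_isRoot]
    simpa using hroot
  have hder : derivative (X ^ p * g + h) = X ^ p * derivative g + derivative h := by
    simp [derivative_pow]
  -- Since `X ^ p` has derivative zero, the Wronskian of `g`, `h` equals that of `g` and the full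
  -- polynomial.
  have h2 : (X - C c) ^ (rootMultiplicity c (X ^ p * g + h) - 1) ∣
      derivative h * g - derivative g * h := by
    have e : derivative h * g - derivative g * h =
        derivative (X ^ p * g + h) * g - derivative g * (X ^ p * g + h) := by
      rw [hder]; ring
    rw [e]
    exact dvd_sub (hd'.mul_right _)
      (((pow_dvd_pow _ (Nat.sub_le _ _)).trans hd).mul_left _)
  obtain ⟨m, hm'⟩ : ∃ m, rootMultiplicity c (X ^ p * g + h) = m + 1 := ⟨_, (Nat.sub_add_cancel hm).symm⟩
  rw [hm', Nat.add_sub_cancel] at h2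
  rw [hm', pow_succ']
  exact mul_dvd_mul h1 h2

theorem natDegree_X_pow_mul_add {R : Type*} [CommRing R] [IsDomain R] {p : ℕ} (hp : 0 < p)
    {g h : R[X]} (hg : g ≠ 0) (hh : h.natDegree ≤ g.natDegree) :
    (X ^ p * g + h).natDegree = p + g.natDegree := by
  have h1 : (X ^ p * g).natDegree = p + g.natDegree := by
    rw [natDegree_mul (pow_ne_zero _ X_ne_zero) hg, natDegree_X_pow]
  rw [natDegree_add_eq_left_of_natDegree_lt (by omega), h1]

theorem natDegree_derivative_mul_le {R : Type*} [CommRing R] {g h : R[X]} {n : ℕ}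
    (hg : g.natDegree ≤ n) (hh : h.natDegree ≤ n) :
    (derivative h * g).natDegree ≤ 2 * n - 1 := by
  rcases Nat.eq_zero_or_pos h.natDegree with h0 | h0
  · rw [eq_C_of_natDegree_eq_zero h0]; simp
  · have := natDegree_derivative_lt h0.ne'
    have := natDegree_mul_le (p := derivative h) (q := g)
    omega

theorem natDegree_eq_zero_of_dvd_derivative {p : ℕ} [Fact p.Prime] {g : (ZMod p)[X]}
    (hlt : g.natDegree < p) (hd : g ∣ derivative g) : g.natDegree = 0 := by
  by_contra h0
  have hz : derivative g = 0 := by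
    by_contra hne
    exact absurd (natDegree_le_of_dvd hd hne) (not_le.2 (natDegree_derivative_lt h0))
  have hc := congrArg (fun q ↦ q.coeff (g.natDegree - 1)) hz
  simp only [coeff_derivative, coeff_zero] at hc
  rw [Nat.sub_add_cancel (Nat.pos_of_ne_zero h0)] at hc
  rcases mul_eq_zero.1 hc with h1 | h1
  · rw [coeff_natDegree, leadingCoeff_eq_zero] at h1
    simp [h1] at h0
  · rw [← Nat.cast_add_one, Nat.sub_add_cancel (Nat.pos_of_ne_zero h0),
      ZMod.natCast_eq_zero_iff] at h1
    exact absurd (Nat.le_of_dvd (Nat.pos_of_ne_zero h0) h1) (not_le.2 hlt)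

/-- With `K = g.natDegree`, a nonzero product in `splits_dvd_mul_wronskian` has degree at most `3 *
K < p + K`, so it must vanish. If `X * g + h = 0`, every field element is a root; if the Wronskian
is zero, coprimality forces `g` and `h` to be constant, leaving a multiple of a `p`-th power. -/
theorem lacunary_of_isCoprime {p : ℕ} [Fact p.Prime] {g h : (ZMod p)[X]} (hg : g ≠ 0)
    (hh : h.natDegree ≤ g.natDegree) (hK : 2 * g.natDegree < p)
    (hs : (X ^ p * g + h).Splits) (hco : IsCoprime g h) :
    (∀ c, (X ^ p * g + h).eval c = 0) ∨ ∃ c, (X + C c) ^ p ∣ X ^ p * g + h := by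
  have hp : 0 < p := (Fact.out : p.Prime).pos
  have hdeg := natDegree_X_pow_mul_add hp hg hh
  have h0 : X ^ p * g + h ≠ 0 := by
    intro h; rw [h, natDegree_zero] at hdeg; omega
  by_cases hne : (X * g + h) * (derivative h * g - derivative g * h) = 0
  · rcases mul_eq_zero.1 hne with h1 | h1
    · left
      intro c
      have := congrArg (eval c) h1
      simpa using this
    · right
      have hgd : g ∣ derivative g := by
        refine hco.dvd_of_dvd_mul_right ?_
        rw [← sub_eq_zero.1 h1]
        exact dvd_mul_left _ _
      have hg0 := natDegree_eq_zero_of_dvd_derivative (by omega) hgd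
      obtain ⟨a, rfl⟩ := natDegree_eq_zero.1 hg0
      obtain ⟨b, rfl⟩ := natDegree_eq_zero.1 (Nat.le_zero.1 (hg0 ▸ hh))
      have ha : a ≠ 0 := by rintro rfl; simp at hg
      refine ⟨b / a, C a, ?_⟩
      have : CharP (ZMod p)[X] p := inferInstance
      rw [add_pow_char, ← C_pow, ZMod.pow_card, add_mul, ← C_mul, div_mul_cancel₀ _ ha]
  · exfalso
    have hle := natDegree_le_of_dvd (splits_dvd_mul_wronskian h0 hs hne) hne
    have h1 : (X * g + h).natDegree ≤ g.natDegree + 1 := by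
      refine (natDegree_add_le _ _).trans (max_le ?_ (by omega))
      refine natDegree_mul_le.trans ?_
      rw [natDegree_X]; omega
    have h2 : (derivative h * g - derivative g * h).natDegree ≤ 2 * g.natDegree - 1 :=
      (natDegree_sub_le _ _).trans (max_le (natDegree_derivative_mul_le le_rfl hh)
        (natDegree_derivative_mul_le hh le_rfl))
    have h3 := natDegree_mul_le (p := X * g + h) (q := derivative h * g - derivative g * h)
    rcases Nat.eq_zero_or_pos g.natDegree with hz | hz
    · obtain ⟨a, rfl⟩ := natDegree_eq_zero.1 hz
      obtain ⟨b, rfl⟩ := natDegree_eq_zero.1 (Nat.le_zero.1 (hz ▸ hh))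
      simp at hne
    · omega

theorem lacunary_splits {p : ℕ} [Fact p.Prime] {g h : (ZMod p)[X]} (hg : g ≠ 0)
    (hh : h.natDegree ≤ g.natDegree) (hK : 2 * g.natDegree < p)
    (hs : (X ^ p * g + h).Splits) :
    (∀ c, (X ^ p * g + h).eval c = 0) ∨ ∃ c, (X + C c) ^ p ∣ X ^ p * g + h := by
  classical
  have hp : 0 < p := (Fact.out : p.Prime).pos
  have h0 : X ^ p * g + h ≠ 0 := by
    intro h'
    have := natDegree_X_pow_mul_add hp hg hh
    rw [h', natDegree_zero] at this; omega
  obtain ⟨d, g₁, h₁, hco, hg₁, hh₁⟩ : ∃ d g₁ h₁ : (ZMod p)[X], IsCoprime g₁ h₁ ∧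
      g = d * g₁ ∧ h = d * h₁ := by
    obtain ⟨g₁, hg₁⟩ := EuclideanDomain.gcd_dvd_left g h
    obtain ⟨h₁, hh₁⟩ := EuclideanDomain.gcd_dvd_right g h
    have hd : EuclideanDomain.gcd g h ≠ 0 := fun h' ↦ hg (EuclideanDomain.gcd_eq_zero_iff.1 h').1
    refine ⟨_, g₁, h₁, ?_, hg₁, hh₁⟩
    have hb := EuclideanDomain.gcd_eq_gcd_ab g h
    refine ⟨EuclideanDomain.gcdA g h, EuclideanDomain.gcdB g h, mul_left_cancel₀ hd ?_⟩
    calc _ = (EuclideanDomain.gcd g h * g₁) * EuclideanDomain.gcdA g h +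
          (EuclideanDomain.gcd g h * h₁) * EuclideanDomain.gcdB g h := by ring
      _ = _ := by rw [← hg₁, ← hh₁, mul_one]; exact hb.symm
  subst hg₁ hh₁
  have hd0 : d ≠ 0 := left_ne_zero_of_mul hg
  have hg0 : g₁ ≠ 0 := right_ne_zero_of_mul hg
  have hf : X ^ p * (d * g₁) + d * h₁ = d * (X ^ p * g₁ + h₁) := by ring
  rw [hf] at hs h0 ⊢
  rw [natDegree_mul hd0 hg0] at hh hK
  have hh' : h₁.natDegree ≤ g₁.natDegree := by
    by_cases hz : h₁ = 0
    · simp [hz]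
    · rw [natDegree_mul hd0 hz] at hh; omega
  rcases lacunary_of_isCoprime hg0 hh' (by omega) (hs.of_dvd h0 (dvd_mul_left _ _)) hco with h | ⟨c, h⟩
  · exact Or.inl fun c ↦ by rw [eval_mul, h, mul_zero]
  · exact Or.inr ⟨c, h.mul_left _⟩

theorem prod_X_add_C_lacunary {p : ℕ} [Fact p.Prime] {ι : Type*} (A : Finset ι) (a : ι → ZMod p)
    {K : ℕ} (hA : A.card = p + K) (hK : 2 * K < p)
    (hgap : ∀ i, K < i → i < p → (∏ v ∈ A, (X + C (a v))).coeff i = 0) :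
    (∀ c, ∃ v ∈ A, a v = c) ∨ ∃ c, p ≤ {v ∈ A | a v = c}.card := by
  classical
  set f : (ZMod p)[X] := ∏ v ∈ A, (X + C (a v)) with hf
  have hmonic : f.Monic := monic_prod_of_monic _ _ fun v _ ↦ monic_X_add_C _
  have hdeg : f.natDegree = p + K := by
    rw [hf, natDegree_prod_of_monic _ _ fun v _ ↦ monic_X_add_C _]
    simp [hA]
  have hsplit : f.Splits := Splits.prod fun v _ ↦ Splits.X_add_C _
  have hfgh : X ^ p * (f /ₘ X ^ p) + f %ₘ X ^ p = f := by
    rw [add_comm]; exact modByMonic_add_div _ _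
  have hgdeg : (f /ₘ X ^ p).natDegree = K := by
    rw [natDegree_divByMonic _ (monic_X_pow p), hdeg, natDegree_X_pow, Nat.add_sub_cancel_left]
  have hg0 : f /ₘ X ^ p ≠ 0 := by
    rw [Ne, divByMonic_eq_zero_iff (monic_X_pow p), degree_X_pow, not_lt,
      degree_eq_natDegree hmonic.ne_zero, hdeg]
    exact_mod_cast Nat.le_add_right p K
  have hhdeg : (f %ₘ X ^ p).natDegree ≤ K := by
    rw [natDegree_le_iff_coeff_eq_zero]
    intro i hi
    by_cases hip : i < p
    · have := hgap i hi hip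
      rw [← hfgh, coeff_add, coeff_X_pow_mul', if_neg (by omega), zero_add] at this
      exact this
    · refine coeff_eq_zero_of_degree_lt ((degree_modByMonic_lt _ (monic_X_pow p)).trans_le ?_)
      rw [degree_X_pow]; exact_mod_cast not_lt.1 hip
  have hroots : f.roots = A.val.map fun v ↦ - a v := by
    have : f = (A.val.map fun v ↦ X - C (- a v)).prod := by
      simp only [C_neg, sub_neg_eq_add]; rfl
    have hcomp : (A.val.map fun v ↦ X - C (- a v)) =
        (A.val.map fun v ↦ - a v).map fun c ↦ X - C c := by
      rw [Multiset.map_map]; rfl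
    rw [this, hcomp, roots_multiset_prod_X_sub_C]
  rcases lacunary_splits hg0 (hhdeg.trans hgdeg.ge) (by omega) (by rwa [hfgh]) with h | ⟨c, h⟩
  · left
    intro c
    have h1 := h (-c)
    rw [hfgh, hf, eval_prod, Finset.prod_eq_zero_iff] at h1
    obtain ⟨v, hv, h2⟩ := h1
    refine ⟨v, hv, ?_⟩
    simpa [neg_add_eq_zero, eq_comm] using h2
  · right
    refine ⟨c, ?_⟩
    rw [hfgh, ← sub_neg_eq_add, ← C_neg, ← le_rootMultiplicity_iff hmonic.ne_zero, ← count_roots,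
      hroots, Multiset.count_map] at h
    simpa [Finset.card_def, eq_comm] using h

end Lacunary

/-! ### Rédei polynomials and blocking in the affine plane. -/

section AffineBlocking

open MvPolynomial

theorem totalDegree_prod_le_card {σ R ι : Type*} [CommRing R] (A : Finset ι)
    (F : ι → MvPolynomial σ R) (hF : ∀ v ∈ A, (F v).totalDegree ≤ 1) :
    (∏ v ∈ A, F v).totalDegree ≤ A.card := by
  refine (totalDegree_finsetProd A F).trans ?_
  simpa using Finset.sum_le_sum hF

theorem totalDegree_linear_le {R : Type*} [CommRing R] [Nontrivial R] (a b c : R) :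
    (C a * X 0 + C b * X 1 + C c : MvPolynomial (Fin 2) R).totalDegree ≤ 1 := by
  refine (totalDegree_add _ _).trans (max_le ((totalDegree_add _ _).trans (max_le ?_ ?_)) ?_)
  · exact (totalDegree_mul _ _).trans (by simp)
  · exact (totalDegree_mul _ _).trans (by simp)
  · simp

/-- The top degree part of `∏ (X₀ + a X₁ + b)` is the homogenization of `∏ (X + a)`. -/
theorem coeff_prod_linear {R ι : Type*} [CommRing R] [Nontrivial R] (a b : ι → R) (A : Finset ι)
    (i j : ℕ) (hij : i + j = A.card) :
    (∏ v ∈ A, (C 1 * X 0 + C (a v) * X 1 + C (b v) : MvPolynomial (Fin 2) R)).coeff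
      (Finsupp.single 0 i + Finsupp.single 1 j) =
    (∏ v ∈ A, (Polynomial.X + Polynomial.C (a v))).coeff i := by
  classical
  induction A using Finset.induction_on generalizing i j with
  | empty =>
    obtain ⟨rfl, rfl⟩ : i = 0 ∧ j = 0 := by simpa using hij
    simp
  | insert v A hv ih =>
    rw [Finset.card_insert_of_notMem hv] at hij
    rw [Finset.prod_insert hv, Finset.prod_insert hv]
    set G := ∏ v ∈ A, (C 1 * X 0 + C (a v) * X 1 + C (b v) : MvPolynomial (Fin 2) R) with hG
    have hGdeg : G.totalDegree ≤ A.card :=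
      totalDegree_prod_le_card A _ fun v _ ↦ totalDegree_linear_le _ _ _
    have hz : G.coeff (Finsupp.single 0 i + Finsupp.single 1 j) = 0 := by
      refine coeff_eq_zero_of_totalDegree_lt ?_
      have : ((Finsupp.single 0 i + Finsupp.single 1 j : Fin 2 →₀ ℕ).degree) = i + j := by simp
      rw [Finsupp.degree_apply] at this
      omega
    rw [add_mul, add_mul, coeff_add, coeff_add, coeff_C_mul, hz, mul_zero, add_zero, C_1, one_mul,
      mul_assoc, coeff_C_mul, add_mul, Polynomial.coeff_add, Polynomial.coeff_C_mul,
      coeff_X_mul', coeff_X_mul']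
    congr 1
    · rcases i with _ | i
      · simp
      · have : (Finsupp.single 0 (i + 1) + Finsupp.single 1 j - Finsupp.single 0 1 : Fin 2 →₀ ℕ) =
            Finsupp.single 0 i + Finsupp.single 1 j := by
          ext k; fin_cases k <;> simp
        rw [if_pos (by simp), this, ih i j (by omega), Polynomial.coeff_X_mul]
    · rcases j with _ | j
      -- Here `i` exceeds the degree of the remaining product.
      · rw [if_neg (by simp), mul_zero, Polynomial.coeff_eq_zero_of_natDegree_lt, mul_zero]
        rw [Polynomial.natDegree_prod_of_monic _ _ fun v _ ↦ Polynomial.monic_X_add_C _]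
        simp; omega
      · have : (Finsupp.single 0 i + Finsupp.single 1 (j + 1) - Finsupp.single 1 1 : Fin 2 →₀ ℕ) =
            Finsupp.single 0 i + Finsupp.single 1 j := by
          ext k; fin_cases k <;> simp
        rw [if_pos (by simp), this, ih i j (by omega)]

variable {p : ℕ} [Fact p.Prime]

/-- If `A` meets all non-vertical lines, then `∏ (X + a)` is lacunary. -/
theorem coeff_prod_X_add_C_eq_zero {ι : Type*} (A : Finset ι) (a b : ι → ZMod p)
    (hA : ∀ t s, ∃ v ∈ A, t + a v * s + b v = 0) {i : ℕ} (hi : i < p)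
    (hlt : A.card < p + i) :
    (∏ v ∈ A, (Polynomial.X + Polynomial.C (a v))).coeff i = 0 := by
  by_cases hiA : i ≤ A.card
  · obtain ⟨j, hj⟩ := Nat.exists_eq_add_of_le hiA
    rw [← coeff_prod_linear a b A i j hj.symm]
    by_contra hne
    set F := ∏ v ∈ A, (C 1 * X 0 + C (a v) * X 1 + C (b v) : MvPolynomial (Fin 2) (ZMod p)) with hF
    have hd : (Finsupp.single 0 i + Finsupp.single 1 j : Fin 2 →₀ ℕ).degree = A.card := by
      simp [hj]
    have hdeg : F.totalDegree = (Finsupp.single 0 i + Finsupp.single 1 j : Fin 2 →₀ ℕ).degree := by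
      refine le_antisymm ?_ ?_
      · rw [hd]
        exact totalDegree_prod_le_card A _ fun v _ ↦ totalDegree_linear_le _ _ _
      · rw [Finsupp.degree_apply]
        exact le_totalDegree (mem_support_iff.2 hne)
    -- Both exponents are below `p`: `i` by hypothesis, `j = A.card - i` by `hlt`.
    obtain ⟨s, -, hs⟩ := combinatorial_nullstellensatz_exists_eval_nonzero F _ hne hdeg
      (fun _ ↦ Finset.univ) (by
        intro k
        rw [Finset.card_univ, ZMod.card]
        fin_cases k <;> simp <;> omega)
    obtain ⟨v, hv, hv0⟩ := hA (s 0) (s 1)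
    apply hs
    rw [hF, eval_prod]
    exact Finset.prod_eq_zero hv (by simpa using hv0)
  · refine Polynomial.coeff_eq_zero_of_natDegree_lt ?_
    rw [Polynomial.natDegree_prod_of_monic _ _ fun v _ ↦ Polynomial.monic_X_add_C _]
    simp; omega

/-- A small set meeting all non-vertical lines meets all vertical ones or contains one. -/
theorem vertical_of_nonvertical_blocking {ι : Type*} (A : Finset ι) (a b : ι → ZMod p)
    (hA : ∀ t s, ∃ v ∈ A, t + a v * s + b v = 0) {K : ℕ} (hcard : A.card = p + K)
    (hK : 2 * K < p) :
    (∀ c, ∃ v ∈ A, a v = c) ∨ ∃ c, p ≤ {v ∈ A | a v = c}.card :=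
  prod_X_add_C_lacunary A a hcard hK fun _ hKi hip ↦
    coeff_prod_X_add_C_eq_zero A a b hA hip (by omega)

/-- Jamison's bound for affine blocking sets. -/
theorem card_affine_blocking {ι : Type*} (A : Finset ι) (a b : ι → ZMod p)
    (hA : ∀ t s u, (s ≠ 0 ∨ u ≠ 0) → ∃ v ∈ A, t + s * a v + u * b v = 0) :
    2 * p - 1 ≤ A.card := by
  classical
  obtain ⟨v₀, hv₀, -⟩ := hA 0 1 0 (Or.inl one_ne_zero)
  -- With `v₀` moved to the origin, the other points meet every line missing the origin. So `F`
  -- vanishes except at `0`, and its values have nonzero sum, impossible in degree below `2 * (p -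
  -- 1)`.
  set F := ∏ v ∈ A.erase v₀, (C (a v - a v₀) * X 0 + C (b v - b v₀) * X 1 + C (-1) :
    MvPolynomial (Fin 2) (ZMod p)) with hF
  by_contra hlt
  have hp := (Fact.out : p.Prime).two_le
  have hdeg : F.totalDegree ≤ A.card - 1 := by
    rw [← Finset.card_erase_of_mem hv₀]
    exact totalDegree_prod_le_card _ _ fun v _ ↦ totalDegree_linear_le _ _ _
  have hpos := Finset.card_pos.2 ⟨v₀, hv₀⟩
  have hsum := sum_eval_eq_zero F (by
    rw [ZMod.card, Fintype.card_fin]; omega)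
  rw [Finset.sum_eq_single 0] at hsum
  · rw [hF, eval_prod, Finset.prod_eq_zero_iff] at hsum
    simp at hsum
  · intro x _ hx
    have hx' : x 0 ≠ 0 ∨ x 1 ≠ 0 := by
      by_contra h
      push Not at h
      exact hx (by ext k; fin_cases k <;> simp [h])
    obtain ⟨v, hv, hv0⟩ := hA (-1 - x 0 * a v₀ - x 1 * b v₀) (x 0) (x 1) hx'
    have hne : v ≠ v₀ := by
      rintro rfl
      have : (-1 : ZMod p) = 0 := by linear_combination hv0
      simp at this
    rw [hF, eval_prod]
    refine Finset.prod_eq_zero (Finset.mem_erase.2 ⟨hne, hv⟩) ?_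
    simp only [map_add, map_mul, eval_C, eval_X]
    linear_combination hv0
  · simp

end AffineBlocking

/-! ### Projective incidence and Blokhuis's theorem. -/

namespace PG2

open Configuration

variable {p : ℕ} [Fact p.Prime]

theorem order_eq : ProjectivePlane.order (Point p) (Line p) = p := by
  classical
  cases nonempty_fintype (Point p)
  have h1 := ProjectivePlane.card_points (Point p) (Line p)
  have h2 := Projectivization.card_of_finrank (ZMod p) (Fin 3 → ZMod p) (n := 3) (by simp)
  rw [Nat.card_eq_fintype_card, h1, Nat.card_eq_fintype_card, ZMod.card] at h2
  simp only [Finset.sum_range_succ, Finset.sum_range_zero] at h2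
  nlinarith

theorem ncard_points (L : Line p) : (Line.points L).ncard = p + 1 := by
  have := ProjectivePlane.pointCount_eq (P := Point p) L
  rw [order_eq] at this
  exact this

theorem ncard_lines_through (P : Point p) : {L : Line p | P ∈ L}.ncard = p + 1 := by
  have := ProjectivePlane.lineCount_eq (L := Line p) P
  rw [order_eq] at this
  exact this

theorem mem_mk_iff (P : Point p) {w : Fin 3 → ZMod p} (hw : w ≠ 0) :
    P ∈ (Projectivization.mk (ZMod p) w hw : Line p) ↔ P.rep ⬝ᵥ w = 0 := by
  conv_lhs => rw [← P.mk_rep]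
  exact mk_mem_points _ _ P.rep_nonzero hw

theorem mem_iff_rep (P : Point p) (L : Line p) : P ∈ L ↔ P.rep ⬝ᵥ L.rep = 0 := by
  rw [← mem_mk_iff P L.rep_nonzero, L.mk_rep]

theorem line_eq_of_mem {P Q : Point p} (hPQ : P ≠ Q) {L M : Line p} (hPL : P ∈ L) (hQL : Q ∈ L)
    (hPM : P ∈ M) (hQM : Q ∈ M) : L = M :=
  (Nondegenerate.eq_or_eq hPL hQL hPM hQM).resolve_left hPQ

theorem smul_rep_add_smul_rep_ne_zero {L M : Line p} (hLM : L ≠ M) {s : ZMod p} (t : ZMod p)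
    (hs : s ≠ 0) : t • L.rep + s • M.rep ≠ 0 := by
  intro h
  apply hLM
  rw [← L.mk_rep, ← M.mk_rep, eq_comm, Projectivization.mk_eq_mk_iff']
  refine ⟨- (s⁻¹ * t), ?_⟩
  have h2 : s⁻¹ • (t • L.rep + s • M.rep) = 0 := by rw [h, smul_zero]
  rw [smul_add, smul_smul, smul_smul, inv_mul_cancel₀ hs, one_smul] at h2
  rw [neg_smul]
  exact neg_eq_of_add_eq_zero_right h2

/-- A blocking set: a set of points meeting every line. -/
def IsBlocking (B : Finset (Point p)) : Prop :=
  ∀ L : Line p, ∃ P ∈ B, P ∈ L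

theorem IsBlocking.exists_line_subset_of_tangent {B : Finset (Point p)} (hB : IsBlocking B)
    (hcard : 2 * B.card ≤ 3 * p + 1) {P : Point p} (hP : P ∈ B) {W₀ : Line p} (hPW : P ∈ W₀)
    (htan : ∀ Q ∈ B, Q ∈ W₀ → Q = P) : ∃ L : Line p, Line.points L ⊆ B := by
  classical
  obtain ⟨W₁, hPW₁, hW₁⟩ : ∃ W₁ : Line p, P ∈ W₁ ∧ W₀ ≠ W₁ := by
    obtain ⟨Q, hQ⟩ := Nondegenerate.exists_point (P := Point p) W₀
    have hne : P ≠ Q := by rintro rfl; exact hQ hPW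
    have := HasLines.mkLine_ax (L := Line p) hne
    exact ⟨_, this.1, fun h ↦ hQ (h ▸ this.2)⟩
  obtain ⟨W₂, hPW₂⟩ := Nondegenerate.exists_line (L := Line p) P
  rw [mem_iff_rep] at hPW hPW₁ hPW₂
  set A := B.erase P with hAdef
  -- Affine coordinates with `W₀` at infinity; as `W₁` passes through `P`, the lines of constant `a`
  -- are those through `P`. The tangent condition keeps the denominators nonzero.
  set a : Point p → ZMod p := fun v ↦ v.rep ⬝ᵥ W₁.rep / v.rep ⬝ᵥ W₀.rep with ha
  set b : Point p → ZMod p := fun v ↦ v.rep ⬝ᵥ W₂.rep / v.rep ⬝ᵥ W₀.rep with hb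
  have hA0 : ∀ v ∈ A, v.rep ⬝ᵥ W₀.rep ≠ 0 := by
    intro v hv h
    rw [hAdef, Finset.mem_erase] at hv
    exact hv.1 (htan v hv.2 ((mem_iff_rep _ _).2 h))
  have hAblock : ∀ t s u, u ≠ 0 → ∃ v ∈ A, t + s * a v + u * b v = 0 := by
    intro t s u hu
    have hPdot : P.rep ⬝ᵥ (t • W₀.rep + s • W₁.rep + u • W₂.rep) ≠ 0 := by
      simp only [dotProduct_add, dotProduct_smul, hPW, hPW₁, smul_eq_mul]
      simpa using ⟨hu, hPW₂⟩
    have hne : t • W₀.rep + s • W₁.rep + u • W₂.rep ≠ 0 := by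
      intro h; rw [h, dotProduct_zero] at hPdot; exact hPdot rfl
    obtain ⟨v, hv, hvL⟩ := hB (Projectivization.mk (ZMod p) _ hne)
    rw [mem_mk_iff] at hvL
    have hvA : v ∈ A := Finset.mem_erase.2 ⟨by rintro rfl; exact hPdot hvL, hv⟩
    refine ⟨v, hvA, ?_⟩
    simp only [dotProduct_add, dotProduct_smul, smul_eq_mul] at hvL
    have := hA0 v hvA
    simp only [ha, hb]
    field_simp
    linear_combination hvL
  have hAp : p ≤ A.card := by
    have : (Finset.univ : Finset (ZMod p)).card ≤ A.card := by
      refine Finset.card_le_card_of_surjOn b fun c _ ↦ ?_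
      obtain ⟨v, hv, h⟩ := hAblock (-c) 0 1 one_ne_zero
      exact ⟨v, hv, by linear_combination h⟩
    rwa [Finset.card_univ, ZMod.card] at this
  have hAB : A.card + 1 = B.card := Finset.card_erase_add_one hP
  obtain ⟨K, hK⟩ := Nat.exists_eq_add_of_le hAp
  have hp := (Fact.out : p.Prime).two_le
  rcases vertical_of_nonvertical_blocking A a b (fun t s ↦ by
    obtain ⟨v, hv, h⟩ := hAblock t s 1 one_ne_zero
    exact ⟨v, hv, by linear_combination h⟩) hK (by omega) with h | ⟨c, h⟩
  · exfalso
    have := card_affine_blocking A a b (fun t s u hsu ↦ by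
      by_cases hu : u = 0
      · have hs : s ≠ 0 := hsu.resolve_right (not_not.2 hu)
        obtain ⟨v, hv, hvc⟩ := h (-t / s)
        refine ⟨v, hv, ?_⟩
        rw [hvc, hu]; field_simp; ring
      · exact hAblock t s u hu)
    omega
  · set M : Line p := Projectivization.mk (ZMod p) _
      (smul_rep_add_smul_rep_ne_zero hW₁ (-c) one_ne_zero) with hM
    refine ⟨M, ?_⟩
    have hPM : P ∈ M := by
      rw [hM, mem_mk_iff]
      simp [dotProduct_add, hPW, hPW₁]
    have hsub : insert P ({v ∈ A | a v = c}) ⊆ B.filter (· ∈ M) := by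
      intro v hv
      rw [Finset.mem_insert, Finset.mem_filter] at hv
      rcases hv with rfl | ⟨hv, hvc⟩
      · exact Finset.mem_filter.2 ⟨hP, hPM⟩
      · refine Finset.mem_filter.2 ⟨Finset.mem_of_mem_erase hv, ?_⟩
        rw [hM, mem_mk_iff]
        simp only [dotProduct_add, dotProduct_smul, smul_eq_mul]
        have := hA0 v hv
        simp only [ha] at hvc
        rw [div_eq_iff this] at hvc
        linear_combination hvc
    have hcardM := Finset.card_le_card hsub
    rw [Finset.card_insert_of_notMem (by simp [hAdef])] at hcardM
    have hsubM : ((B.filter (· ∈ M) : Finset (Point p)) : Set (Point p)) ⊆ Line.points M := by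
      intro v hv
      exact (Finset.mem_filter.1 hv).2
    have heq := Set.eq_of_subset_of_ncard_le hsubM (by
      rw [ncard_points, Set.ncard_coe_finset]; omega)
    rw [← heq]
    exact_mod_cast Finset.filter_subset _ B

/-- Blokhuis: a blocking set of `PG(2, p)` with fewer than `3 (p + 1) / 2` points contains a
line. -/
theorem IsBlocking.exists_line_subset {B : Finset (Point p)} (hB : IsBlocking B)
    (hcard : 2 * B.card ≤ 3 * p + 1) : ∃ L : Line p, Line.points L ⊆ B := by
  classical
  induction B using Finset.strongInduction with
  | H B ih =>
    obtain ⟨L₀⟩ : Nonempty (Line p) := inferInstance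
    obtain ⟨P, hP, -⟩ := hB L₀
    by_cases hmin : IsBlocking (B.erase P)
    · obtain ⟨L, hL⟩ := ih _ (Finset.erase_ssubset hP) hmin
        ((Nat.mul_le_mul_left 2 (Finset.card_le_card (Finset.erase_subset P B))).trans hcard)
      exact ⟨L, hL.trans (by exact_mod_cast Finset.erase_subset P B)⟩
    · simp only [IsBlocking] at hmin
      push Not at hmin
      obtain ⟨W, hW⟩ := hmin
      have htan : ∀ Q ∈ B, Q ∈ W → Q = P := fun Q hQ hQW ↦ by
        by_contra hne
        exact hW Q (Finset.mem_erase.2 ⟨hne, hQ⟩) hQW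
      obtain ⟨Q, hQ, hQW⟩ := hB W
      exact hB.exists_line_subset_of_tangent hcard hP (htan Q hQ hQW ▸ hQW) htan

/-! ### Pencil counting and sets without tangents. -/

theorem le_ncard_diff_of_pencil {Q : Point p} {L : Line p} (hQ : Q ∈ L) (T : Set (Point p))
    (hT : ∀ N : Line p, Q ∈ N → N ≠ L → ∃ P ∈ T, P ∈ N ∧ P ≠ Q) :
    p ≤ (T \ Line.points L).ncard := by
  classical
  choose! f hf using hT
  have hcard : ({N : Line p | Q ∈ N} \ {L}).ncard = p := by
    rw [Set.ncard_sdiff_singleton_of_mem (show L ∈ {N : Line p | Q ∈ N} from hQ), ncard_lines_through, Nat.add_sub_cancel]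
  -- Lines of the pencil share only `Q`, so the chosen points are distinct and off `L`.
  refine hcard.ge.trans (Set.ncard_le_ncard_of_injOn f ?_ ?_)
  · rintro N ⟨hN, hNL⟩
    obtain ⟨h1, h2, h3⟩ := hf N hN hNL
    exact ⟨h1, fun h ↦ hNL (line_eq_of_mem h3 h2 hN h hQ)⟩
  · rintro N ⟨hN, hNL⟩ N' ⟨hN', hNL'⟩ h
    obtain ⟨-, h2, h3⟩ := hf N hN hNL
    obtain ⟨-, h2', -⟩ := hf N' hN' hNL'
    exact line_eq_of_mem h3 h2 hN (h ▸ h2') hN'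

theorem WithoutTangents.exists_ne_mem {S : Set (Point p)} (hS : WithoutTangents S) {Q : Point p}
    (hQ : Q ∈ S) {N : Line p} (hN : Q ∈ N) : ∃ P ∈ S, P ∈ N ∧ P ≠ Q := by
  by_contra! h
  refine hS N (Set.ncard_eq_one.2 ⟨Q, Set.eq_singleton_iff_unique_mem.2 ⟨⟨hQ, hN⟩, ?_⟩⟩)
  rintro P ⟨hP, hPN⟩
  exact h P hP hPN

theorem WithoutTangents.le_ncard_diff {S : Set (Point p)} (hS : WithoutTangents S) {Q : Point p}
    (hQ : Q ∈ S) {L : Line p} (hQL : Q ∈ L) : p ≤ (S \ Line.points L).ncard :=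
  le_ncard_diff_of_pencil hQL S fun _ hN _ ↦ hS.exists_ne_mem hQ hN

theorem WithoutTangents.isTrivial {S : Set (Point p)} (hne : S.Nonempty) (hS : WithoutTangents S)
    (hcard : S.ncard ≤ 2 * p) (L : Line p)
    (hx : 2 * S.ncard + 1 ≤ 4 * (S ∩ Line.points L).ncard + p) : IsTrivial S := by
  classical
  have hp := (Fact.out : p.Prime).two_le
  have hsplit : (S ∩ Line.points L).ncard + (S \ Line.points L).ncard = S.ncard :=
    Set.ncard_inter_add_ncard_sdiff_eq_ncard S _
  have hLsplit : (S ∩ Line.points L).ncard + (Line.points L \ S).ncard = p + 1 := by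
    rw [← ncard_points L, Set.inter_comm]
    exact Set.ncard_inter_add_ncard_sdiff_eq_ncard _ S
  obtain ⟨Q₀, hQ₀, hQ₀L⟩ : (S ∩ Line.points L).Nonempty := by
    rw [← Set.ncard_pos]
    by_contra h0
    obtain ⟨Q, hQ⟩ := hne
    obtain ⟨N, hN⟩ : ∃ N : Line p, Q ∈ N := by
      have h := ncard_lines_through Q
      exact Set.nonempty_of_ncard_ne_zero (s := {N : Line p | Q ∈ N}) (by omega)
    have h1 := hS.le_ncard_diff hQ hN
    have h2 := Set.ncard_le_ncard (Set.sdiff_subset : S \ Line.points N ⊆ S)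
    omega
  have hoff : p ≤ (S \ Line.points L).ncard := hS.le_ncard_diff hQ₀ hQ₀L
  set B : Finset (Point p) :=
    (Set.toFinite ((S \ Line.points L) ∪ (Line.points L \ S))).toFinset with hBdef
  have hmemB : ∀ P, P ∈ B ↔ (P ∈ S ∧ P ∉ L) ∨ (P ∈ L ∧ P ∉ S) := fun P ↦ by
    rw [hBdef, Set.Finite.mem_toFinset]; rfl
  -- With `x` points of `S` on `L`, the two pieces of `B` have `|S| - x` and `p + 1 - x` points.
  have hBcard : 2 * B.card ≤ 3 * p + 1 := by
    have : B.card ≤ (S \ Line.points L).ncard + (Line.points L \ S).ncard := by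
      rw [hBdef, ← Set.ncard_eq_toFinset_card]
      exact Set.ncard_union_le _ _
    omega
  have hB : IsBlocking B := by
    intro N
    by_cases hNL : N = L
    · obtain ⟨P, hPL, hPS⟩ : (Line.points L \ S).Nonempty := by
        rw [← Set.ncard_pos]; omega
      exact ⟨P, (hmemB P).2 (Or.inr ⟨hPL, hPS⟩), hNL ▸ hPL⟩
    · obtain ⟨hQN, hQL⟩ := HasPoints.mkPoint_ax (P := Point p) hNL
      set Q : Point p := HasPoints.mkPoint hNL
      by_cases hQS : Q ∈ S
      · obtain ⟨P, hP, hPN, hPQ⟩ := hS.exists_ne_mem hQS hQN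
        exact ⟨P, (hmemB P).2 (Or.inl ⟨hP, fun hPL ↦
          hNL (line_eq_of_mem hPQ hPN hQN hPL hQL)⟩), hPN⟩
      · exact ⟨Q, (hmemB Q).2 (Or.inr ⟨hQL, hQS⟩), hQN⟩
  obtain ⟨M, hM⟩ := hB.exists_line_subset hBcard
  have hML : L ≠ M := by
    rintro rfl
    rcases (hmemB Q₀).1 (hM hQ₀L) with h | h
    · exact h.2 hQ₀L
    · exact h.2 hQ₀
  obtain ⟨hRL, hRM⟩ := HasPoints.mkPoint_ax (P := Point p) hML
  set R : Point p := HasPoints.mkPoint hML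
  have hR : ∀ P : Point p, P ∈ L → P ∈ M → P = R := fun P h1 h2 ↦ by
    by_contra h
    exact hML (line_eq_of_mem h h1 hRL h2 hRM)
  have hMS : Line.points M \ {R} ⊆ S := by
    rintro P ⟨hPM, hPR⟩
    rcases (hmemB P).1 (hM hPM) with h | h
    · exact h.1
    · exact absurd (hR P h.1 hPM) hPR
  have hMcard : (Line.points M \ {R}).ncard = p := by
    rw [Set.ncard_sdiff_singleton_of_mem (show R ∈ Line.points M from hRM), ncard_points, Nat.add_sub_cancel]
  have hLcard : (Line.points L \ {R}).ncard = p := by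
    rw [Set.ncard_sdiff_singleton_of_mem (show R ∈ Line.points L from hRL), ncard_points, Nat.add_sub_cancel]
  have hLS : Line.points L \ {R} ⊆ S := by
    rintro d ⟨hdL, hdR⟩
    by_contra hdS
    -- Each further line through `d` meets `M` in a point of `S`, hence has another point of `S`,
    -- off `M`. Together with `M` minus `R` this puts `2 * p` points of `S` off `L`, while `Q₀` lies
    -- on `L`.
    have hpen := le_ncard_diff_of_pencil hdL (S \ Line.points M) (by
      intro N hdN hNL
      have hNM : N ≠ M := by
        rintro rfl; exact hdR (hR d hdL hdN)
      obtain ⟨hPN, hPM⟩ := HasPoints.mkPoint_ax (P := Point p) hNM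
      set P : Point p := HasPoints.mkPoint hNM
      have hPR : P ≠ R := by
        intro h
        rw [h] at hPN
        exact hNL (line_eq_of_mem hdR hdN hPN hdL hRL)
      obtain ⟨P', hP'S, hP'N, hP'⟩ := hS.exists_ne_mem (hMS ⟨hPM, hPR⟩) hPN
      exact ⟨P', ⟨hP'S, fun h ↦ hNM (line_eq_of_mem hP' hP'N hPN h hPM)⟩, hP'N,
        fun h ↦ hdS (h ▸ hP'S)⟩)
    have hsub : ((S \ Line.points M) \ Line.points L) ∪ (Line.points M \ {R}) ⊆
        S \ Line.points L := by
      rintro P (⟨⟨h1, -⟩, h2⟩ | ⟨h1, h2⟩)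
      · exact ⟨h1, h2⟩
      · exact ⟨hMS ⟨h1, h2⟩, fun h ↦ h2 (hR P h h1)⟩
    have hle := Set.ncard_le_ncard hsub
    rw [Set.ncard_union_eq (Set.disjoint_left.2 fun P h1 h2 ↦ h1.1.2 h2.1), hMcard] at hle
    omega
  refine ⟨L, M, hML, ?_⟩
  have hunion : (Line.points L ∪ Line.points M) \ (Line.points L ∩ Line.points M) =
      (Line.points L \ {R}) ∪ (Line.points M \ {R}) := by
    have : Line.points L ∩ Line.points M = {R} :=
      Set.eq_singleton_iff_unique_mem.2 ⟨⟨hRL, hRM⟩, fun P h ↦ hR P h.1 h.2⟩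
    rw [this, Set.union_sdiff_distrib]
  rw [hunion]
  refine (Set.eq_of_subset_of_ncard_le (Set.union_subset hLS hMS) ?_).symm
  rw [Set.ncard_union_eq (Set.disjoint_left.2 fun P h1 h2 ↦ h1.2 (hR P h1.1 h2.1)), hLcard, hMcard]
  omega

end PG2

theorem mainTheorem4 (p : ℕ) [Fact p.Prime] (S : Set (PG2.Point p)) (hne : S.Nonempty)
    (hS : PG2.WithoutTangents S) (hcard : S.ncard ≤ 2 * p)
    (L : PG2.Line p) (x : ℕ) (hx : (S ∩ PG2.Line.points L).ncard = x)
    (hxge : (S.ncard : ℝ) / 2 - ((p : ℝ) - 1) / 4 ≤ (x : ℝ)) :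
    PG2.IsTrivial S := by
  refine hS.isTrivial hne hcard L ?_
  rw [hx]
  have h : (2 * S.ncard + 1 : ℝ) ≤ 4 * x + p := by linarith
  exact_mod_cast h
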